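/- Let \(\mathcal X,\mathcal Y\) be non-empty finite sets and let \(c\in(\mathbb R_+)^{\mathcal X\times\mathcal Y}\). All spaces carry the Euclidean inner product and norm. Let \(A:\mathbb R^{\mathcal X\times\mathcal Y}\to\mathbb R^{\mathcal X}\oplus\mathbb R^{\mathcal Y}\), \(A\gamma=\big((\sum_y\gamma_{x,y})_x,(\sum_x\gamma_{x,y})_y\big)\), with adjoint \(A^*(\varphi,\psi)=(\varphi_x+\psi_y)_{x,y}\). Let \(\mathrm{Ent}(\gamma)=\sum_{x,y}\gamma_{x,y}(\log\gamma_{x,y}-1)\) if \(\gamma\ge 0\) (with \(0\log 0=0\)), and \(+\infty\) otherwise. Let \(F:\mathbb R^{\mathcal X}\oplus\mathbb R^{\mathcal Y}\to\mathbb R\cup\{+\infty\}\), with Legendre–Fenchel transform \(F^*(z)=\sup_p\langle p,z\rangle-F(p)\) and \(\operatorname{dom}F=\{F<+\infty\}\), satisfy: (H1) \(F\) is proper, convex and lower semicontinuous; (H2) \(F(p)<+\infty\) for some \(p\) with all coordinates positive; (H3) \(F(p)/\|p\|\to+\infty\) as \(\|p\|\to+\infty\); (H4) there is a neighborhood \(W\)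 of the origin such that every \(p\in W\) with nonnegative coordinates belongs to \(\operatorname{dom}F\); (H5) \(F^*\) is strongly convex at every point \(z_0\) of its domain: there are \(r>0\), \(g\in\partial F^*(z_0)\) and \(\lambda>0\) with \(F^*(z)\ge F^*(z_0)+\langle g,z-z_0\rangle+\frac\lambda2\|z-z_0\|^2\) for all \(z\in B(z_0,r)\cap\operatorname{dom}F^*\); (H6) \(F^*\) is \(C^2\) on the interior of its domain. Consider, for \(t>0\), the problems \[(\mathrm{UOT})\ \min_{\gamma\ge 0}\ \langle c,\gamma\rangle+F(A\gamma),\qquad(\mathrm{UOT}_t)\ \min_{\gamma\in\mathbb R^{\mathcal X\times\mathcal Y}}\ \langle c,\gamma\rangle+F(A\gamma)+\tfrac1t\mathrm{Ent}(\gamma),\] \[(\mathrm{Dual}_t)\ \min_{\xi\in\mathbb R^{\mathcal X}\oplus\mathbb R^{\mathcal Y}}\ F^*(-\xi)+\sum_{x,y}\tfrac1t\exp\big(t\,(A^*\xi-c)_{x,y}\big).\] Then for every \(t>0\), \((\mathrm{UOT}_t)\) has a unique solution \(\gamma(t)\), \((\mathrm{Dual}_t)\) has a unique solution \(\xi(t)\),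 and \(\gamma(t)=\exp\big(t(A^*\xi(t)-c)\big)\) coordinatewise. Among the solutions of \((\mathrm{UOT})\) there is a unique one, \(\gamma^*\), of minimal entropy. Moreover there are constants \(C>0\) and \(T>0\), depending only on \(\mathcal X,\mathcal Y,c,F\), such that \[\|\gamma(t)-\gamma^*\|\le\frac{C}{\sqrt t}\qquad\text{for all }t\ge T.\] -/

import Mathlib

open Filter Topology Set

namespace UOT

noncomputable section

/-! ### Convex analysis for functions with values in `ℝ ∪ {+∞}`

An extended-real-valued function is a map into `EReal`; properness excludes the value `-∞`. -/

section ConvexAnalysis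

variable {E : Type*} [NormedAddCommGroup E] [InnerProductSpace ℝ E]

/-- The effective domain of `f`. -/
def dom (f : E → EReal) : Set E := {x | f x < ⊤}

/-- `f` never takes the value `-∞` and is not identically `+∞`. -/
def Proper (f : E → EReal) : Prop := (∀ x, f x ≠ ⊥) ∧ ∃ x, f x ≠ ⊤

/-- Convexity by Jensen's inequality. (In `EReal`, `0 * ⊤ = 0`, and `⊤` absorbs every summand
other than `⊥`, so this is the usual notion for functions that avoid `-∞`.) -/
def Convex (f : E → EReal) : Prop :=
  ∀ (x y : E) (a b : ℝ), 0 ≤ a → 0 ≤ b → a + b = 1 →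
    f (a • x + b • y) ≤ (a : EReal) * f x + (b : EReal) * f y

/-- `f(x) / ‖x‖ → +∞` as `‖x‖ → +∞`. -/
def SuperLinear (f : E → EReal) : Prop :=
  Tendsto (fun x => f x / ((‖x‖ : ℝ) : EReal)) (Bornology.cobounded E) (𝓝 ⊤)

/-- The Legendre–Fenchel transform `f*(z) = sup_x (⟨x, z⟩ - f(x))`. -/
def conj (f : E → EReal) (z : E) : EReal := ⨆ x : E, ((inner ℝ x z : ℝ) : EReal) - f x

/-- The convex subdifferential `∂f(x₀)`. -/
def subdiff (f : E → EReal) (x₀ : E) : Set E :=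
  {g | ∀ x, f x₀ + ((inner ℝ g (x - x₀) : ℝ) : EReal) ≤ f x}

/-- Strong convexity at the point `x₀`: a subgradient inequality at `x₀` with a positive quadratic
gain on some ball around `x₀`. -/
def StronglyConvexAt (f : E → EReal) (x₀ : E) : Prop :=
  ∃ r : ℝ, 0 < r ∧ ∃ g ∈ subdiff f x₀, ∃ l : ℝ, 0 < l ∧
    ∀ x ∈ Metric.ball x₀ r ∩ dom f,
      f x₀ + ((inner ℝ g (x - x₀) + l / 2 * ‖x - x₀‖ ^ 2 : ℝ) : EReal) ≤ f x

end ConvexAnalysis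

/-! ### Discrete unbalanced optimal transport -/

variable {X Y : Type*} [Fintype X] [Fintype Y]

/-- Transport plans: vectors of `ℝ^{X × Y}`, with the Euclidean norm. -/
abbrev Plan (X Y : Type*) := EuclideanSpace ℝ (X × Y)

/-- The space `ℝ^X ⊕ ℝ^Y`, of pairs of marginals and of pairs of potentials, with the Euclidean
norm. -/
abbrev Pair (X Y : Type*) := EuclideanSpace ℝ (X ⊕ Y)

/-- The marginal map `A γ = ((∑_y γ_{x,y})_x, (∑_x γ_{x,y})_y)`. -/
def A (g : Plan X Y) : Pair X Y :=
  WithLp.toLp 2 (Sum.elim (fun x => ∑ y, g (x, y)) (fun y => ∑ x, g (x, y)))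

/-- The map `A* (φ, ψ) = (φ_x + ψ_y)_{x,y}`. -/
def Astar (xi : Pair X Y) : Plan X Y :=
  WithLp.toLp 2 (fun p => xi (Sum.inl p.1) + xi (Sum.inr p.2))

/-- `A*` is the adjoint of `A` for the Euclidean inner products. -/
theorem inner_A_eq (g : Plan X Y) (xi : Pair X Y) :
    inner ℝ (A g) xi = inner ℝ g (Astar xi) := by
  simp only [PiLp.inner_apply, A, Astar, Fintype.sum_sum_type, Fintype.sum_prod_type,
    Sum.elim_inl, Sum.elim_inr, RCLike.inner_apply, conj_trivial, Finset.mul_sum, add_mul,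
    Finset.sum_add_distrib]
  congr 1
  exact Finset.sum_comm

/-- The discrete entropy `∑ γ_{x,y} (log γ_{x,y} - 1)` on the nonnegative orthant (with
`0 log 0 = 0`), and `+∞` elsewhere. -/
def entropy (g : Plan X Y) : EReal :=
  open Classical in
  if ∀ p, 0 ≤ g p then ((∑ p, g p * (Real.log (g p) - 1) : ℝ) : EReal) else ⊤

/-- The unregularized cost `⟨c | γ⟩ + F(A γ)`. -/
def cost (c : Plan X Y) (F : Pair X Y → EReal) (g : Plan X Y) : EReal :=
  ((∑ p, c p * g p : ℝ) : EReal) + F (A g)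

/-- The regularized cost `⟨c | γ⟩ + F(A γ) + (1/t) Ent(γ)`. -/
def regCost (c : Plan X Y) (F : Pair X Y → EReal) (t : ℝ) (g : Plan X Y) : EReal :=
  cost c F g + ((1 / t : ℝ) : EReal) * entropy g

/-- The regularized dual functional
`F*(-ξ) + ∑_{x,y} (1/t) exp (t (φ_x + ψ_y - c(x,y)))`, with `ξ = (φ, ψ)`. -/
def regDual (c : Plan X Y) (F : Pair X Y → EReal) (t : ℝ) (xi : Pair X Y) : EReal :=
  conj F (-xi) + ((∑ p, 1 / t * Real.exp (t * (Astar xi p - c p)) : ℝ) : EReal)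

/-- `γ` solves the regularized problem, a minimization over all of `ℝ^{X × Y}`. -/
def IsRegPlan (c : Plan X Y) (F : Pair X Y → EReal) (t : ℝ) (g : Plan X Y) : Prop :=
  ∀ g', regCost c F t g ≤ regCost c F t g'

/-- `ξ` solves the regularized dual problem. -/
def IsRegDual (c : Plan X Y) (F : Pair X Y → EReal) (t : ℝ) (xi : Pair X Y) : Prop :=
  ∀ xi', regDual c F t xi ≤ regDual c F t xi'

/-- `γ` solves the unregularized problem, a minimization over nonnegative plans. -/
def IsOptPlan (c : Plan X Y) (F : Pair X Y → EReal) (g : Plan X Y) : Prop :=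
  (∀ p, 0 ≤ g p) ∧ ∀ g' : Plan X Y, (∀ p, 0 ≤ g' p) → cost c F g ≤ cost c F g'

/-- `γ` has minimal entropy among the solutions of the unregularized problem. -/
def IsMinEntropyOptPlan (c : Plan X Y) (F : Pair X Y → EReal) (g : Plan X Y) : Prop :=
  IsOptPlan c F g ∧ ∀ g', IsOptPlan c F g' → entropy g ≤ entropy g'

/-- The standing assumptions on the marginal penalty `F`. -/
structure Assumptions (F : Pair X Y → EReal) : Prop where
  proper : Proper F
  convex : Convex F
  lsc : LowerSemicontinuous F
  /-- `F` is finite at some pair of positive vectors. -/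
  exists_pos : ∃ p : Pair X Y, (∀ z, 0 < p z) ∧ F p < ⊤
  superLinear : SuperLinear F
  /-- `F` is finite on the nonnegative vectors of some neighborhood of the origin. -/
  near_zero : ∃ W ∈ 𝓝 (0 : Pair X Y), W ∩ {p | ∀ z, 0 ≤ p z} ⊆ dom F
  /-- The transform `F*` is strongly convex at every point of its domain. -/
  conj_strong : ∀ z ∈ dom (conj F), StronglyConvexAt (conj F) z
  /-- The transform `F*` is of class `C²` on the interior of its domain. -/
  conj_smooth : ContDiffOn ℝ 2 (fun z => (conj F z).toReal) (interior (dom (conj F)))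

end

end UOT

/-! Superlinearity of `F` makes `F*` finite everywhere, hence `C²` on the whole space, and strongly
convex at each point. The regularized dual is coercive and strictly convex; its optimality condition
`A γ(t) = ∇F*(-ξ(t))`, with `γ(t) = exp (t (A* ξ(t) - c))`, certifies through Fenchel–Young and
Kullback–Leibler that `γ(t)` is the unique primal solution. A cluster point `(ξ₀, g₀)` as `t → ∞` is
a saddle point of the unregularized problem (`exists_isSaddle`), and `ξ₀` then certifies every
optimal plan, in particular `γ*`.

For the rate, testing the dual at `ξ₀` shows that the gap of `F*` above its tangent at `-ξ₀` is
`O(1/t)` (`IsSaddle.conjFn_gap_le`), so strong convexity gives `‖ξ(t) - ξ₀‖ = O(1/√t)`. Since `∇F*`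
is Lipschitz at `-ξ₀`, the marginals of `γ(t)` and the slackness `⟨c - A* ξ₀, γ(t)⟩` are within
`O(1/√t)` of those of `γ*`.

Passing from these data to the plan itself is the crux, as the linear map `slackMarginal` has a
kernel. Vectors of that kernel are orthogonal to `log γ(t)`, while minimality of entropy makes their
pairing with `log γ*` nonnegative. As `log` is increasing, no nonzero kernel vector has signs
compatible with `γ(t) - γ*` (`IsSaddle.eq_zero_of_signCompatible`). There are finitely many sign
patterns, so a compactness bound of Hoffman type (`exists_norm_le_of_signCompatible`) controls
`‖γ(t) - γ*‖` by its image, uniformly in `t`. -/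

namespace UOT

/-! ### Legendre–Fenchel transforms of superlinear functions -/

section ConvexAnalysis

variable {E : Type*} [NormedAddCommGroup E] [InnerProductSpace ℝ E]

/-- The Legendre–Fenchel transform of a proper superlinear lower semicontinuous function is finite
and attained. -/
theorem conj_attained [FiniteDimensional ℝ E] {f : E → EReal} (hp : Proper f)
    (hl : LowerSemicontinuous f) (hs : SuperLinear f) (z : E) :
    ∃ (p : E) (r : ℝ), f p = r ∧ conj f z = ((inner ℝ p z - r : ℝ) : EReal) := by
  obtain ⟨hbot, p₀, hp₀⟩ := hp
  obtain ⟨r₀, hr₀⟩ : ∃ r₀ : ℝ, f p₀ = r₀ := ⟨_, (EReal.coe_toReal hp₀ (hbot p₀)).symm⟩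
  set h : E → EReal := fun p => f p + ((-inner ℝ p z : ℝ) : EReal) with hh
  have hlsc : LowerSemicontinuous h := by
    refine LowerSemicontinuous.add' hl ?_ ?_
    · exact (continuous_coe_real_ereal.comp (by fun_prop)).lowerSemicontinuous
    · intro x
      exact EReal.continuousAt_add (Or.inr (EReal.coe_ne_bot _)) (Or.inr (EReal.coe_ne_top _))
  -- With slope `‖z‖ + 1`, Cauchy–Schwarz leaves `h q > ‖q‖` far out.
  have hev := (EReal.tendsto_nhds_top_iff_real.1 hs) (‖z‖ + 1)
  obtain ⟨R, hR⟩ : ∃ R : ℝ, ∀ p : E, R < ‖p‖ → ((‖z‖ + 1 : ℝ) : EReal) < f p / ((‖p‖ : ℝ) : EReal) := by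
    rw [← comap_norm_atTop, eventually_comap] at hev
    obtain ⟨R, hR⟩ := (hev.and (eventually_gt_atTop (0:ℝ))).exists_forall_of_atTop
    exact ⟨R, fun p hp => (hR ‖p‖ hp.le).1 p rfl⟩
  -- The last entry is `h p₀`, so points outside the ball do worse than `p₀`, which lies inside.
  set R' := max (max R 0) (max ‖p₀‖ (r₀ - inner ℝ p₀ z)) with hR'
  obtain ⟨p, hpmem, hpmin⟩ := (hlsc.lowerSemicontinuousOn (Metric.closedBall 0 R')).exists_isMinOn
    ⟨p₀, by simp [hR']⟩ (isCompact_closedBall (0 : E) R')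
  have hmin : ∀ q, h p ≤ h q := by
    intro q
    by_cases hq : ‖q‖ ≤ R'
    · exact hpmin (by simpa using hq)
    · push Not at hq
      have h0 : h p ≤ h p₀ := hpmin (by simp [hR'])
      have hq0 : 0 < ‖q‖ := lt_of_le_of_lt (by simp [hR']) hq
      have hqR : R < ‖q‖ := lt_of_le_of_lt (by simp [hR']) hq
      have hqr : r₀ - inner ℝ p₀ z < ‖q‖ := lt_of_le_of_lt (by simp [hR']) hq
      have h1 := hR q hqR
      refine h0.trans ?_
      by_cases htop : f q = ⊤
      · simp [hh, htop]
      obtain ⟨s, hs⟩ : ∃ s : ℝ, f q = s := ⟨_, (EReal.coe_toReal htop (hbot q)).symm⟩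
      rw [hs] at h1
      rw [← EReal.coe_div, EReal.coe_lt_coe_iff] at h1
      rw [lt_div_iff₀ hq0] at h1
      have h3 := real_inner_le_norm q z
      simp only [hh, hs, hr₀]
      norm_cast
      nlinarith
  have hptop : f p ≠ ⊤ := by
    intro htop
    have := hmin p₀
    simp only [hh, htop, hr₀] at this
    rw [EReal.top_add_coe] at this
    norm_cast at this
  obtain ⟨r, hr⟩ : ∃ r : ℝ, f p = r := ⟨_, (EReal.coe_toReal hptop (hbot p)).symm⟩
  refine ⟨p, r, hr, le_antisymm (iSup_le fun q => ?_) ?_⟩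
  · by_cases htop : f q = ⊤
    · simp [htop]
    obtain ⟨s, hs⟩ : ∃ s : ℝ, f q = s := ⟨_, (EReal.coe_toReal htop (hbot q)).symm⟩
    have := hmin q
    simp only [hh, hs, hr] at this ⊢
    norm_cast at this ⊢
    linarith
  · refine le_trans ?_ (le_iSup _ p)
    rw [hr]
    norm_cast

variable [FiniteDimensional ℝ E] {f : E → EReal}

theorem coe_conj_toReal (hp : Proper f) (hl : LowerSemicontinuous f) (hs : SuperLinear f) (z : E) :
    (((conj f z).toReal : ℝ) : EReal) = conj f z := by
  obtain ⟨p, r, -, h⟩ := conj_attained hp hl hs z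
  rw [h, EReal.toReal_coe]

theorem dom_conj_eq_univ (hp : Proper f) (hl : LowerSemicontinuous f) (hs : SuperLinear f) :
    dom (conj f) = univ := by
  refine eq_univ_of_forall fun z => ?_
  change conj f z < ⊤
  rw [← coe_conj_toReal hp hl hs]
  exact EReal.coe_lt_top _

/-- The Fenchel–Young inequality. -/
theorem inner_sub_le_conj_toReal (hp : Proper f) (hl : LowerSemicontinuous f) (hs : SuperLinear f)
    {p : E} {r : ℝ} (h : f p = r) (z : E) : inner ℝ p z - r ≤ (conj f z).toReal := by
  rw [← EReal.coe_le_coe_iff, coe_conj_toReal hp hl hs]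
  refine le_trans ?_ (le_iSup _ p)
  rw [h]
  norm_cast

theorem convexOn_conj_toReal (hp : Proper f) (hl : LowerSemicontinuous f) (hs : SuperLinear f) :
    ConvexOn ℝ univ fun z => (conj f z).toReal := by
  refine ⟨convex_univ, fun x _ y _ a b ha hb hab => ?_⟩
  obtain ⟨p, r, hr, h⟩ := conj_attained hp hl hs (a • x + b • y)
  have hx := inner_sub_le_conj_toReal hp hl hs hr x
  have hy := inner_sub_le_conj_toReal hp hl hs hr y
  simp only [h, EReal.toReal_coe, smul_eq_mul, inner_add_right, inner_smul_right]
  obtain rfl : b = 1 - a := by linarith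
  nlinarith [mul_le_mul_of_nonneg_left hx ha, mul_le_mul_of_nonneg_left hy hb]

/-- A point attaining the Legendre–Fenchel transform at `z` is its gradient there. -/
theorem eq_gradient_of_attained (hp : Proper f) (hl : LowerSemicontinuous f) (hs : SuperLinear f)
    {z p : E} {r : ℝ} (hr : f p = r) (h : (conj f z).toReal = inner ℝ p z - r) {g : E}
    (hg : HasGradientAt (fun z => (conj f z).toReal) g z) : p = g := by
  have hmin : IsLocalMin (fun w => (conj f w).toReal - inner ℝ p w) z := by
    refine Filter.Eventually.of_forall fun w => ?_
    have := inner_sub_le_conj_toReal hp hl hs hr w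
    simp only [h]
    linarith
  have hd : HasFDerivAt (fun w => (conj f w).toReal - inner ℝ p w)
      (InnerProductSpace.toDual ℝ E g - innerSL ℝ p) z :=
    hg.hasFDerivAt.sub (innerSL ℝ p).hasFDerivAt
  have h0 := hmin.hasFDerivAt_eq_zero hd
  refine ext_inner_right ℝ fun v => ?_
  have := congrArg (fun L : E →L[ℝ] ℝ => L v) h0
  simp at this
  linarith

/-- A point of strong convexity of a differentiable convex function has quadratic growth above the
tangent hyperplane near the point, and the gap stays bounded below away from it. -/
theorem exists_quadratic_growth (hp : Proper f) (hl : LowerSemicontinuous f) (hs : SuperLinear f)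
    {z₀ g : E} (hg : HasGradientAt (fun z => (conj f z).toReal) g z₀)
    (h : StronglyConvexAt (conj f) z₀) :
    ∃ r > 0, ∃ l > 0,
      (∀ z, ‖z - z₀‖ ≤ r →
        l * ‖z - z₀‖ ^ 2 ≤ (conj f z).toReal - (conj f z₀).toReal - inner ℝ g (z - z₀)) ∧
      ∀ z, r ≤ ‖z - z₀‖ →
        l * r ^ 2 ≤ (conj f z).toReal - (conj f z₀).toReal - inner ℝ g (z - z₀) := by
  obtain ⟨r, hr, g', hg', l, hl0, hq⟩ := h
  have hsub : ∀ z, inner ℝ g' (z - z₀) ≤ (conj f z).toReal - (conj f z₀).toReal := by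
    intro z
    have := hg' z
    rw [← coe_conj_toReal hp hl hs z, ← coe_conj_toReal hp hl hs z₀] at this
    norm_cast at this
    linarith
  -- At a point of differentiability the gradient is the only subgradient.
  obtain rfl : g' = g := by
    have hmin : IsLocalMin (fun w => (conj f w).toReal - inner ℝ g' w) z₀ := by
      refine Filter.Eventually.of_forall fun w => ?_
      have := hsub w
      rw [inner_sub_right] at this
      simp only
      linarith
    have hd : HasFDerivAt (fun w => (conj f w).toReal - inner ℝ g' w)
        (InnerProductSpace.toDual ℝ E g - innerSL ℝ g') z₀ :=
      hg.hasFDerivAt.sub (innerSL ℝ g').hasFDerivAt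
    have h0 := hmin.hasFDerivAt_eq_zero hd
    refine ext_inner_right ℝ fun v => ?_
    have := congrArg (fun L : E →L[ℝ] ℝ => L v) h0
    simp at this
    linarith
  have hnear : ∀ z, ‖z - z₀‖ ≤ r / 2 →
      l / 2 * ‖z - z₀‖ ^ 2 ≤ (conj f z).toReal - (conj f z₀).toReal - inner ℝ g' (z - z₀) := by
    intro z hz
    have := hq z ⟨by rw [mem_ball_iff_norm]; linarith, by
      rw [dom_conj_eq_univ hp hl hs]; trivial⟩
    rw [← coe_conj_toReal hp hl hs z, ← coe_conj_toReal hp hl hs z₀] at this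
    norm_cast at this
    linarith
  refine ⟨r / 2, by positivity, l / 2, by positivity, hnear, fun z hz => ?_⟩
  have hd : 0 < ‖z - z₀‖ := by linarith
  -- The segment from `z₀` to `z` meets the sphere of radius `r / 2` at parameter `s`. By convexity
  -- the gap there is at most `s ≤ 1` times the gap at `z`.
  set s := r / 2 / ‖z - z₀‖ with hs'
  have hs0 : 0 < s := by positivity
  have hs1 : s ≤ 1 := by rw [hs', div_le_one hd]; exact hz
  have hc := (convexOn_conj_toReal hp hl hs).2 (mem_univ z₀) (mem_univ z)
    (sub_nonneg.2 hs1) hs0.le (by ring)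
  have hpt : (1 - s) • z₀ + s • z - z₀ = s • (z - z₀) := by module
  have hn : ‖(1 - s) • z₀ + s • z - z₀‖ = r / 2 := by
    rw [hpt, norm_smul, Real.norm_of_nonneg hs0.le, hs']
    field_simp
  have h1 := hnear _ hn.le
  rw [hn, hpt, inner_smul_right] at h1
  simp only [smul_eq_mul] at hc
  have h2 := hsub z
  nlinarith

theorem inner_lt_conj_sub (hp : Proper f) (hl : LowerSemicontinuous f) (hs : SuperLinear f)
    {z₀ g z : E} (hg : HasGradientAt (fun z => (conj f z).toReal) g z₀)
    (h : StronglyConvexAt (conj f) z₀) (hz : z ≠ z₀) :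
    inner ℝ g (z - z₀) < (conj f z).toReal - (conj f z₀).toReal := by
  obtain ⟨r, hr, l, hl0, h1, h2⟩ := exists_quadratic_growth hp hl hs hg h
  have hd : 0 < ‖z - z₀‖ := norm_pos_iff.2 (sub_ne_zero.2 hz)
  rcases le_total ‖z - z₀‖ r with h' | h'
  · have := h1 z h'
    have : 0 < l * ‖z - z₀‖ ^ 2 := by positivity
    linarith
  · have := h2 z h'
    have : 0 < l * r ^ 2 := by positivity
    linarith

end ConvexAnalysis

end UOT

/-! ### The Kullback–Leibler inequality and a Hoffman-type bound -/

namespace UOT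

/-- `x log y - y ≤ x log x - x`: nonnegativity of the Kullback–Leibler divergence of two reals. -/
theorem mul_log_sub_le {x y : ℝ} (hx : 0 ≤ x) (hy : 0 < y) :
    x * Real.log y - y ≤ x * Real.log x - x := by
  rcases hx.eq_or_lt with rfl | hx
  · simp [hy.le]
  · have h := Real.log_le_sub_one_of_pos (div_pos hy hx)
    rw [Real.log_div hy.ne' hx.ne'] at h
    have h2 := mul_le_mul_of_nonneg_left h hx.le
    have h3 : x * (y / x - 1) = y - x := by field_simp
    linarith

theorem mul_log_sub_lt {x y : ℝ} (hx : 0 ≤ x) (hy : 0 < y) (hxy : x ≠ y) :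
    x * Real.log y - y < x * Real.log x - x := by
  rcases hx.eq_or_lt with rfl | hx
  · simp [hy]
  · have h := Real.log_lt_sub_one_of_pos (div_pos hy hx) (by
      rw [ne_eq, div_eq_one_iff_eq hx.ne']; exact hxy.symm)
    rw [Real.log_div hy.ne' hx.ne'] at h
    have h2 := mul_lt_mul_of_pos_left h hx
    have h3 : x * (y / x - 1) = y - x := by field_simp
    linarith

/-- `k` lies in the closed orthant cut out by the signs of `v`: it is nonnegative where `v` is
positive, nonpositive where `v` is negative and zero where `v` is zero. -/
def SignCompatible {ι : Type*} (k v : ι → ℝ) : Prop :=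
  ∀ i, (0 ≤ v i → 0 ≤ k i) ∧ (v i ≤ 0 → k i ≤ 0)

/-- A linear map is bounded below, uniformly in `v`, at those vectors `v` whose closed sign orthant
meets its kernel trivially. -/
theorem exists_norm_le_of_signCompatible {ι E : Type*} [Fintype ι] [NormedAddCommGroup E]
    [NormedSpace ℝ E] (B : EuclideanSpace ℝ ι →ₗ[ℝ] E) :
    ∃ C > 0, ∀ v : EuclideanSpace ℝ ι,
      (∀ k : EuclideanSpace ℝ ι, B k = 0 → SignCompatible k v → k = 0) → ‖v‖ ≤ C * ‖B v‖ := by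
  -- Only the sign pattern of `v` matters: `K` is the set of unit vectors of its closed orthant. If
  -- the kernel of `B` meets `K`, the hypothesis on `v` fails; otherwise `‖B k‖` has a positive
  -- minimum on `K`.
  have key : ∀ s t : Set ι, ∃ C > 0, ∀ v : EuclideanSpace ℝ ι,
      {i | 0 ≤ v i} = s → {i | v i ≤ 0} = t →
      (∀ k : EuclideanSpace ℝ ι, B k = 0 → SignCompatible k v → k = 0) → ‖v‖ ≤ C * ‖B v‖ := by
    intro s t
    set K : Set (EuclideanSpace ℝ ι) :=
      Metric.sphere 0 1 ∩ ((⋂ i ∈ s, {k | 0 ≤ k i}) ∩ ⋂ i ∈ t, {k | k i ≤ 0}) with hK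
    have hKc : IsCompact K := by
      refine (isCompact_sphere _ _).inter_right (IsClosed.inter ?_ ?_)
      · exact isClosed_biInter fun i _ => isClosed_le (by fun_prop) (by fun_prop)
      · exact isClosed_biInter fun i _ => isClosed_le (by fun_prop) (by fun_prop)
    by_cases hker : ∃ k ∈ K, B k = 0
    · obtain ⟨k, hk, hBk⟩ := hker
      refine ⟨1, one_pos, fun v hs ht hv => ?_⟩
      exfalso
      have h0 := hv k hBk fun i => ⟨fun hi => ?_, fun hi => ?_⟩
      · rw [h0] at hk
        simpa using hk.1
      · exact mem_iInter₂.1 hk.2.1 i (hs ▸ hi)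
      · exact mem_iInter₂.1 hk.2.2 i (ht ▸ hi)
    · push Not at hker
      have hcont : Continuous fun k => ‖B k‖ := B.continuous_of_finiteDimensional.norm
      obtain ⟨m, hm, hmK⟩ : ∃ m > 0, ∀ k ∈ K, m ≤ ‖B k‖ := by
        rcases K.eq_empty_or_nonempty with he | hne
        · exact ⟨1, one_pos, by simp [he]⟩
        · obtain ⟨k, hk, hmin⟩ := hKc.exists_isMinOn hne hcont.continuousOn
          exact ⟨‖B k‖, norm_pos_iff.2 (hker k hk), fun q hq => hmin hq⟩
      refine ⟨m⁻¹, inv_pos.2 hm, fun v hs ht hv => ?_⟩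
      rcases eq_or_ne v 0 with rfl | hv0
      · simp
      have hn : 0 < ‖v‖ := norm_pos_iff.2 hv0
      have hmem : ‖v‖⁻¹ • v ∈ K := by
        refine ⟨by simp [norm_smul, hn.ne'], mem_iInter₂.2 fun i hi => ?_,
          mem_iInter₂.2 fun i hi => ?_⟩
        · rw [← hs] at hi
          exact mul_nonneg (inv_pos.2 hn).le hi
        · rw [← ht] at hi
          exact mul_nonpos_of_nonneg_of_nonpos (inv_pos.2 hn).le hi
      have := hmK _ hmem
      rw [map_smul, norm_smul, norm_inv, norm_norm, inv_mul_eq_div, le_div_iff₀ hn] at this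
      rw [inv_mul_eq_div, le_div_iff₀ hm]
      linarith
  choose C hC hCv using key
  -- The sum over the finitely many patterns dominates each constant.
  refine ⟨∑ q : Set ι × Set ι, C q.1 q.2, Finset.sum_pos (fun q _ => hC _ _) ⟨(∅, ∅), by simp⟩,
    fun v hv => (hCv _ _ v rfl rfl hv).trans ?_⟩
  refine mul_le_mul_of_nonneg_right ?_ (norm_nonneg _)
  exact Finset.single_le_sum (f := fun q : Set ι × Set ι => C q.1 q.2)
    (fun q _ => (hC _ _).le) (Finset.mem_univ ({i | 0 ≤ v i}, {i | v i ≤ 0}))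

end UOT

/-! ### Exponential plans, marginals and the transform of the penalty -/

namespace UOT

noncomputable section

/-- The Legendre–Fenchel transform as a real-valued function. -/
def conjFn {E : Type*} [NormedAddCommGroup E] [InnerProductSpace ℝ E] (f : E → EReal) (z : E) : ℝ :=
  (conj f z).toReal

variable {X Y : Type*}

/-- The plan `exp (t (A* ξ - c))` attached to a pair of potentials. -/
def planOf (c : Plan X Y) (t : ℝ) (xi : Pair X Y) : Plan X Y :=
  WithLp.toLp 2 fun p => Real.exp (t * (Astar xi p - c p))

theorem planOf_apply (c : Plan X Y) (t : ℝ) (xi : Pair X Y) (p : X × Y) :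
    planOf c t xi p = Real.exp (t * (Astar xi p - c p)) := rfl

theorem planOf_pos (c : Plan X Y) (t : ℝ) (xi : Pair X Y) (p : X × Y) : 0 < planOf c t xi p :=
  Real.exp_pos _

theorem log_planOf (c : Plan X Y) (t : ℝ) (xi : Pair X Y) (p : X × Y) :
    Real.log (planOf c t xi p) = t * (Astar xi p - c p) := Real.log_exp _

variable [Fintype X] [Fintype Y]

section Linear

/-- The marginal map as a linear map. -/
def marginal (X Y : Type*) [Fintype X] [Fintype Y] : Plan X Y →ₗ[ℝ] Pair X Y where
  toFun := A
  map_add' g h := by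
    ext z; cases z <;> simp [A, Finset.sum_add_distrib]
  map_smul' a g := by
    ext z; cases z <;> simp [A, Finset.mul_sum]

/-- The adjoint of the marginal map as a linear map. -/
def potentialSum (X Y : Type*) [Fintype X] [Fintype Y] : Pair X Y →ₗ[ℝ] Plan X Y where
  toFun := Astar
  map_add' g h := by
    ext z; simp [Astar]; ring
  map_smul' a g := by
    ext z; simp [Astar]; ring

theorem A_add (g h : Plan X Y) : A (g + h) = A g + A h := (marginal X Y).map_add g h
theorem A_smul (a : ℝ) (g : Plan X Y) : A (a • g) = a • A g := (marginal X Y).map_smul a g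
theorem Astar_add (g h : Pair X Y) : Astar (g + h) = Astar g + Astar h :=
  (potentialSum X Y).map_add g h
theorem Astar_sub (g h : Pair X Y) : Astar (g - h) = Astar g - Astar h :=
  (potentialSum X Y).map_sub g h
theorem Astar_smul (a : ℝ) (g : Pair X Y) : Astar (a • g) = a • Astar g :=
  (potentialSum X Y).map_smul a g

@[fun_prop]
theorem continuous_A : Continuous (A : Plan X Y → Pair X Y) :=
  (marginal X Y).continuous_of_finiteDimensional

@[fun_prop]
theorem continuous_Astar : Continuous (Astar : Pair X Y → Plan X Y) :=
  (potentialSum X Y).continuous_of_finiteDimensional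

theorem sum_mul_Astar (g : Plan X Y) (xi : Pair X Y) :
    ∑ p, g p * Astar xi p = inner ℝ (A g) xi := by
  rw [inner_A_eq, PiLp.inner_apply]
  exact Finset.sum_congr rfl fun p _ => by simp [mul_comm]

end Linear

/-- The regularized dual functional as a real-valued function. -/
def dualFn (c : Plan X Y) (F : Pair X Y → EReal) (t : ℝ) (xi : Pair X Y) : ℝ :=
  conjFn F (-xi) + ∑ p, 1 / t * Real.exp (t * (Astar xi p - c p))

/-- The entropy of a nonnegative plan, as a real number. -/
def entropyFn (g : Plan X Y) : ℝ := ∑ p, g p * (Real.log (g p) - 1)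

theorem entropy_of_nonneg {g : Plan X Y} (hg : ∀ p, 0 ≤ g p) :
    entropy g = (entropyFn g : EReal) := by
  rw [entropy, if_pos hg, entropyFn]

theorem entropy_of_not_nonneg {g : Plan X Y} (hg : ¬ ∀ p, 0 ≤ g p) : entropy g = ⊤ := by
  rw [entropy, if_neg hg]

section Conjugate

variable {F : Pair X Y → EReal}

theorem coe_conjFn (hF : Assumptions F) (z : Pair X Y) : ((conjFn F z : ℝ) : EReal) = conj F z :=
  coe_conj_toReal hF.proper hF.lsc hF.superLinear z

theorem contDiff_conjFn (hF : Assumptions F) : ContDiff ℝ 2 (conjFn F) := by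
  have h := hF.conj_smooth
  rw [dom_conj_eq_univ hF.proper hF.lsc hF.superLinear, interior_univ, contDiffOn_univ] at h
  exact h

theorem hasGradientAt_conjFn (hF : Assumptions F) (z : Pair X Y) :
    HasGradientAt (conjFn F) (gradient (conjFn F) z) z :=
  (((contDiff_conjFn hF).differentiable (by norm_num)) z).hasGradientAt

theorem contDiff_gradient_conjFn (hF : Assumptions F) : ContDiff ℝ 1 (gradient (conjFn F)) := by
  have h : ContDiff ℝ 1 (fderiv ℝ (conjFn F)) :=
    (contDiff_conjFn hF).fderiv_right (by norm_num)
  exact (InnerProductSpace.toDual ℝ (Pair X Y)).symm.toContinuousLinearEquiv.contDiff.comp h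

theorem eq_gradient_conjFn (hF : Assumptions F) {p z : Pair X Y}
    (h : F p = ((inner ℝ p z - conjFn F z : ℝ) : EReal)) : p = gradient (conjFn F) z := by
  refine eq_gradient_of_attained hF.proper hF.lsc hF.superLinear h ?_ (hasGradientAt_conjFn hF z)
  rw [conjFn]; ring

theorem apply_gradient_conjFn (hF : Assumptions F) (z : Pair X Y) :
    F (gradient (conjFn F) z) =
      ((inner ℝ (gradient (conjFn F) z) z - conjFn F z : ℝ) : EReal) := by
  obtain ⟨p, r, hr, h⟩ := conj_attained hF.proper hF.lsc hF.superLinear z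
  rw [← coe_conjFn hF, EReal.coe_eq_coe_iff] at h
  have hp : F p = ((inner ℝ p z - conjFn F z : ℝ) : EReal) := by rw [hr, h]; congr 1; ring
  rwa [eq_gradient_conjFn hF hp] at hp

theorem coe_inner_sub_conjFn_le (hF : Assumptions F) (p z : Pair X Y) :
    ((inner ℝ p z - conjFn F z : ℝ) : EReal) ≤ F p := by
  by_cases htop : F p = ⊤
  · simp [htop]
  have h : F p = ((F p).toReal : EReal) := (EReal.coe_toReal htop (hF.proper.1 p)).symm
  have := inner_sub_le_conj_toReal hF.proper hF.lsc hF.superLinear h z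
  rw [h, EReal.coe_le_coe_iff, conjFn]
  linarith

theorem stronglyConvexAt_conj (hF : Assumptions F) (z : Pair X Y) :
    StronglyConvexAt (conj F) z :=
  hF.conj_strong z (by rw [dom_conj_eq_univ hF.proper hF.lsc hF.superLinear]; trivial)

theorem inner_lt_conjFn_sub (hF : Assumptions F) {z₀ z : Pair X Y} (hz : z ≠ z₀) :
    inner ℝ (gradient (conjFn F) z₀) (z - z₀) < conjFn F z - conjFn F z₀ :=
  inner_lt_conj_sub hF.proper hF.lsc hF.superLinear (hasGradientAt_conjFn hF z₀)
    (stronglyConvexAt_conj hF z₀) hz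

/-- Differentiability of the gradient at the single point `z₀` suffices, since the rate only
compares with the limit. -/
theorem exists_lipschitz_gradient_conjFn (hF : Assumptions F) (z₀ : Pair X Y) :
    ∃ L > 0, ∃ r > 0, ∀ z, ‖z - z₀‖ < r →
      ‖gradient (conjFn F) z - gradient (conjFn F) z₀‖ ≤ L * ‖z - z₀‖ := by
  have hd := (contDiff_gradient_conjFn hF).differentiable (by norm_num) z₀
  obtain ⟨L, hL, h⟩ := hd.isBigO_sub.exists_pos
  obtain ⟨r, hr, hr'⟩ := Metric.eventually_nhds_iff.1 h.bound
  exact ⟨L, hL, r, hr, fun z hz => hr' (by rwa [dist_eq_norm])⟩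

/-- Finiteness of `F` at small nonnegative vectors bounds the transform from below. -/
theorem exists_le_conjFn (hF : Assumptions F) :
    ∃ d > 0, ∃ M : ℝ, ∀ z : Pair X Y, -M ≤ conjFn F z ∧ ∀ i, d * z i - M ≤ conjFn F z := by
  classical
  obtain ⟨W, hW, hWF⟩ := hF.near_zero
  obtain ⟨ε, hε, hball⟩ := Metric.mem_nhds_iff.1 hW
  have hfin : ∀ p : Pair X Y, ‖p‖ < ε → (∀ z, 0 ≤ p z) → F p = ((F p).toReal : EReal) := by
    intro p hp hp0
    have : F p < ⊤ := hWF ⟨hball (by simpa using hp), hp0⟩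
    exact (EReal.coe_toReal this.ne (hF.proper.1 p)).symm
  have hle : ∀ p : Pair X Y, ‖p‖ < ε → (∀ z, 0 ≤ p z) → ∀ z,
      inner ℝ p z - (F p).toReal ≤ conjFn F z := fun p hp hp0 z =>
    inner_sub_le_conj_toReal hF.proper hF.lsc hF.superLinear (hfin p hp hp0) z
  -- Fenchel–Young is tested on `0` and on one small positive vector along each axis.
  let e : X ⊕ Y → Pair X Y := fun i => EuclideanSpace.single i (ε / 2)
  refine ⟨ε / 2, by positivity, |(F 0).toReal| + ∑ i, |(F (e i)).toReal|, fun z => ⟨?_, ?_⟩⟩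
  · have h := hle 0 (by simpa using hε) (by simp) z
    have h1 : 0 ≤ ∑ i, |(F (e i)).toReal| := Finset.sum_nonneg fun _ _ => abs_nonneg _
    have h2 := le_abs_self (F 0).toReal
    rw [inner_zero_left] at h
    linarith
  · intro i
    have h := hle (e i) (by simp [e, abs_of_pos hε]; linarith) (by
      intro j
      by_cases hj : j = i
      · subst hj; simp [e]; positivity
      · simp [e, hj]) z
    have h1 := Finset.single_le_sum (f := fun i => |(F (e i)).toReal|) (fun _ _ => abs_nonneg _)
      (Finset.mem_univ i)
    have h2 := le_abs_self (F (e i)).toReal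
    have h3 : inner ℝ (e i) z = ε / 2 * z i := by
      simp [e, EuclideanSpace.inner_single_left]
    have h4 := abs_nonneg (F 0).toReal
    linarith

end Conjugate

/-! ### The regularized dual problem -/

section Dual

variable {c : Plan X Y} {F : Pair X Y → EReal}

theorem regDual_eq_coe (hF : Assumptions F) (t : ℝ) (xi : Pair X Y) :
    regDual c F t xi = (dualFn c F t xi : EReal) := by
  rw [regDual, ← coe_conjFn hF, dualFn, EReal.coe_add]

theorem isRegDual_iff (hF : Assumptions F) (t : ℝ) (xi : Pair X Y) :
    IsRegDual c F t xi ↔ ∀ xi', dualFn c F t xi ≤ dualFn c F t xi' := by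
  simp only [IsRegDual, regDual_eq_coe hF, EReal.coe_le_coe_iff]

/-- Sublevel sets of the regularized dual functionals are bounded, uniformly in `t`. -/
theorem exists_norm_le_of_dualFn_le [Nonempty X] [Nonempty Y] (hF : Assumptions F) (a : ℝ) :
    ∃ R, ∀ t > 0, ∀ xi, dualFn c F t xi ≤ a → ‖xi‖ ≤ R := by
  obtain ⟨d, hd, M, hM⟩ := exists_le_conjFn hF
  set b := (a + M) / d
  set k := a + M + ∑ p, |c p| + b
  refine ⟨√(∑ _i : X ⊕ Y, (|b| + |k|) ^ 2), fun t ht xi hxi => ?_⟩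
  have hpos : ∀ p, 0 < 1 / t * Real.exp (t * (Astar xi p - c p)) := fun p => by positivity
  have hsum : ∀ p, 1 / t * Real.exp (t * (Astar xi p - c p)) ≤
      ∑ p, 1 / t * Real.exp (t * (Astar xi p - c p)) := fun p =>
    Finset.single_le_sum (f := fun p => 1 / t * Real.exp (t * (Astar xi p - c p)))
      (fun p _ => (hpos p).le) (Finset.mem_univ p)
  -- The transform term bounds each coordinate from below; the exponentials bound the sums `φ_x +
  -- ψ_y` from above. Together they bound each coordinate on both sides.
  have hlow : ∀ i, -b ≤ xi i := by
    intro i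
    have h1 := (hM (-xi)).2 i
    have h2 : 0 ≤ ∑ p, 1 / t * Real.exp (t * (Astar xi p - c p)) :=
      Finset.sum_nonneg fun p _ => (hpos p).le
    rw [dualFn] at hxi
    simp only [PiLp.neg_apply] at h1
    rw [neg_le, le_div_iff₀ hd]
    linarith
  have hpair : ∀ p : X × Y, xi (Sum.inl p.1) + xi (Sum.inr p.2) ≤ a + M + ∑ p, |c p| := by
    intro p
    have h1 := (hM (-xi)).1
    have h2 := hsum p
    rw [dualFn] at hxi
    -- The bound `exp (t s) / t ≥ s` removes the dependence on `t`.
    have h3 : Astar xi p - c p ≤ 1 / t * Real.exp (t * (Astar xi p - c p)) := by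
      have := Real.add_one_le_exp (t * (Astar xi p - c p))
      rw [one_div, inv_mul_eq_div, le_div_iff₀ ht]
      linarith
    have h4 := Finset.single_le_sum (f := fun p => |c p|) (fun _ _ => abs_nonneg _)
      (Finset.mem_univ p)
    have h5 := le_abs_self (c p)
    have h6 : Astar xi p = xi (Sum.inl p.1) + xi (Sum.inr p.2) := rfl
    simp only at h4
    linarith
  have hup : ∀ i, xi i ≤ k := by
    rintro (x | y)
    · obtain ⟨y⟩ := ‹Nonempty Y›
      have := hpair (x, y)
      have := hlow (Sum.inr y)
      simp only at *
      linarith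
    · obtain ⟨x⟩ := ‹Nonempty X›
      have := hpair (x, y)
      have := hlow (Sum.inl x)
      simp only at *
      linarith
  rw [EuclideanSpace.norm_eq]
  refine Real.sqrt_le_sqrt (Finset.sum_le_sum fun i _ => ?_)
  refine pow_le_pow_left₀ (norm_nonneg _) ?_ 2
  rw [Real.norm_eq_abs, abs_le]
  have := hlow i
  have := hup i
  have := le_abs_self b
  have := le_abs_self k
  have := abs_nonneg b
  have := abs_nonneg k
  constructor <;> linarith

theorem continuous_dualFn (hF : Assumptions F) (t : ℝ) : Continuous (dualFn c F t) := by
  have := (contDiff_conjFn hF).continuous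
  unfold dualFn
  fun_prop

theorem exists_isRegDual [Nonempty X] [Nonempty Y] (hF : Assumptions F) {t : ℝ} (ht : 0 < t) :
    ∃ xi, IsRegDual c F t xi := by
  obtain ⟨R, hR⟩ := exists_norm_le_of_dualFn_le (c := c) hF (dualFn c F t 0)
  have h0 : (0 : Pair X Y) ∈ Metric.closedBall 0 R := by
    simpa using hR t ht 0 le_rfl
  obtain ⟨xi, -, hmin⟩ := (isCompact_closedBall (0 : Pair X Y) R).exists_isMinOn ⟨0, h0⟩
    (continuous_dualFn (c := c) hF t).continuousOn
  refine ⟨xi, (isRegDual_iff hF t xi).2 fun xi' => ?_⟩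
  rcases le_total (dualFn c F t xi') (dualFn c F t 0) with h | h
  · exact hmin (by simpa using hR t ht xi' h)
  · exact le_trans (hmin h0) h

/-- First-order optimality in the regularized dual problem. -/
theorem A_planOf_eq (hF : Assumptions F) {t : ℝ} (ht : 0 < t) {xi : Pair X Y}
    (h : IsRegDual c F t xi) : A (planOf c t xi) = gradient (conjFn F) (-xi) := by
  rw [isRegDual_iff hF] at h
  refine ext_inner_right ℝ fun v => ?_
  have hline : HasDerivAt (fun s : ℝ => -(xi + s • v)) (-v) 0 := by
    have := (((hasDerivAt_id' (0 : ℝ)).smul_const v).const_add xi).fun_neg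
    rwa [one_smul] at this
  have h1 : HasDerivAt (fun s : ℝ => conjFn F (-(xi + s • v)))
      (inner ℝ (gradient (conjFn F) (-xi)) (-v)) 0 := by
    have hg := (hasGradientAt_conjFn hF (-(xi + (0 : ℝ) • v))).hasFDerivAt
    have := hg.comp_hasDerivAt (0 : ℝ) hline
    rw [zero_smul, add_zero] at this
    exact this
  have h2 : ∀ p : X × Y, HasDerivAt
      (fun s : ℝ => 1 / t * Real.exp (t * (Astar (xi + s • v) p - c p)))
      (planOf c t xi p * Astar v p) 0 := by
    intro p
    have hl : HasDerivAt (fun s : ℝ => t * (Astar (xi + s • v) p - c p)) (t * Astar v p) 0 := by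
      have := ((((hasDerivAt_id (0 : ℝ)).mul_const (Astar v p)).const_add
        (Astar xi p)).sub_const (c p)).const_mul t
      simpa [Astar_add, Astar_smul] using this
    have := hl.exp.const_mul (1 / t)
    refine this.congr_deriv ?_
    simp only [zero_smul, add_zero, planOf_apply]
    field_simp
  have h3 : HasDerivAt (fun s : ℝ => dualFn c F t (xi + s • v))
      (inner ℝ (gradient (conjFn F) (-xi)) (-v) + ∑ p, planOf c t xi p * Astar v p) 0 :=
    h1.add (HasDerivAt.fun_sum fun p _ => h2 p)
  have hmin : IsLocalMin (fun s : ℝ => dualFn c F t (xi + s • v)) 0 :=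
    Filter.Eventually.of_forall fun s => by simpa using h (xi + s • v)
  have h0 := hmin.hasDerivAt_eq_zero h3
  rw [sum_mul_Astar, inner_neg_right] at h0
  linarith

/-- The tangent inequalities for `exp` and for `F*` are added, and the linear terms cancel by the
first-order condition. Strictness has to come from `F*`, because `A*` has a kernel. -/
theorem dualFn_lt_dualFn (hF : Assumptions F) {t : ℝ} (ht : 0 < t) {xi xi' : Pair X Y}
    (h : A (planOf c t xi) = gradient (conjFn F) (-xi)) (hne : xi' ≠ xi) :
    dualFn c F t xi < dualFn c F t xi' := by
  have h1 := inner_lt_conjFn_sub hF (z₀ := -xi) (z := -xi') (by simpa using hne)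
  have h2 : ∑ p, (1 / t * Real.exp (t * (Astar xi p - c p)) +
      planOf c t xi p * Astar (xi' - xi) p) ≤
      ∑ p, 1 / t * Real.exp (t * (Astar xi' p - c p)) := by
    refine Finset.sum_le_sum fun p _ => ?_
    have h := Real.add_one_le_exp (t * Astar (xi' - xi) p)
    have h' := mul_le_mul_of_nonneg_left h (planOf_pos c t xi p).le
    rw [planOf_apply, ← Real.exp_add] at h'
    have he : t * (Astar xi p - c p) + t * Astar (xi' - xi) p = t * (Astar xi' p - c p) := by
      rw [Astar_sub]; simp; ring
    rw [he] at h'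
    have h'' := mul_le_mul_of_nonneg_left h' (one_div_pos.2 ht).le
    refine le_trans (le_of_eq ?_) h''
    rw [planOf_apply]
    field_simp
    ring
  rw [Finset.sum_add_distrib, sum_mul_Astar, h] at h2
  have h3 : -xi' - -xi = -(xi' - xi) := by abel
  rw [h3, inner_neg_right] at h1
  rw [dualFn, dualFn]
  linarith

theorem IsRegDual.eq (hF : Assumptions F) {t : ℝ} (ht : 0 < t) {xi xi' : Pair X Y}
    (h : IsRegDual c F t xi) (h' : IsRegDual c F t xi') : xi' = xi := by
  by_contra hne
  have := dualFn_lt_dualFn hF ht (A_planOf_eq hF ht h) hne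
  exact absurd ((isRegDual_iff hF t xi').1 h' xi) (not_le.2 this)

end Dual

/-! ### Duality and the regularized primal problem -/

section Primal

variable {c : Plan X Y} {F : Pair X Y → EReal}

theorem sum_sub_Astar_mul (c g : Plan X Y) (xi : Pair X Y) :
    ∑ p, (c p - Astar xi p) * g p = ∑ p, c p * g p - inner ℝ (A g) xi := by
  rw [← sum_mul_Astar, ← Finset.sum_sub_distrib]
  exact Finset.sum_congr rfl fun p _ => by ring

/-- Weak duality. -/
theorem le_cost (hF : Assumptions F) (g : Plan X Y) (xi : Pair X Y) :
    ((∑ p, (c p - Astar xi p) * g p - conjFn F (-xi) : ℝ) : EReal) ≤ cost c F g := by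
  have h := coe_inner_sub_conjFn_le hF (A g) (-xi)
  rw [cost, sum_sub_Astar_mul]
  refine le_trans (le_of_eq ?_) (add_le_add_right h _)
  rw [← EReal.coe_add, inner_neg_right]
  congr 1
  ring

/-- Equality in weak duality is equality in Fenchel–Young, which differentiability of `F*` allows
only at the gradient. -/
theorem cost_eq_iff (hF : Assumptions F) (g : Plan X Y) (xi : Pair X Y) :
    cost c F g = ((∑ p, (c p - Astar xi p) * g p - conjFn F (-xi) : ℝ) : EReal) ↔
      A g = gradient (conjFn F) (-xi) := by
  rw [cost, sum_sub_Astar_mul]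
  constructor
  · intro h
    refine eq_gradient_conjFn hF ?_
    have htop : F (A g) ≠ ⊤ := by
      intro htop
      rw [htop, EReal.coe_add_top] at h
      exact EReal.coe_ne_top _ h.symm
    have hr : F (A g) = ((F (A g)).toReal : EReal) :=
      (EReal.coe_toReal htop (hF.proper.1 _)).symm
    rw [hr] at h ⊢
    rw [← EReal.coe_add, EReal.coe_eq_coe_iff] at h
    rw [EReal.coe_eq_coe_iff, inner_neg_right]
    linarith
  · intro h
    have := apply_gradient_conjFn hF (-xi)
    rw [← h] at this
    rw [this, ← EReal.coe_add, inner_neg_right]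
    congr 1
    ring

theorem regCost_planOf (hF : Assumptions F) {t : ℝ} (ht : 0 < t) {xi : Pair X Y}
    (h : A (planOf c t xi) = gradient (conjFn F) (-xi)) :
    regCost c F t (planOf c t xi) =
      ((-conjFn F (-xi) - 1 / t * ∑ p, planOf c t xi p : ℝ) : EReal) := by
  rw [regCost, (cost_eq_iff hF _ _).2 h, entropy_of_nonneg fun p => (planOf_pos c t xi p).le,
    ← EReal.coe_mul, ← EReal.coe_add, entropyFn]
  congr 1
  simp only [log_planOf, Finset.mul_sum]
  have : ∑ p, 1 / t * (planOf c t xi p * (t * (Astar xi p - c p) - 1)) =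
      -∑ p, (c p - Astar xi p) * planOf c t xi p - ∑ p, 1 / t * planOf c t xi p := by
    rw [← Finset.sum_neg_distrib, ← Finset.sum_sub_distrib]
    refine Finset.sum_congr rfl fun p _ => ?_
    field_simp
    ring
  rw [this]
  ring

/-- Weak duality bounds the cost of `g`. Since `log (planOf c t xi)` is `t (A* ξ - c)`, the
Kullback–Leibler inequality between `g` and `planOf c t xi` absorbs the slackness term, strictly
when the two differ. -/
theorem regCost_planOf_lt (hF : Assumptions F) {t : ℝ} (ht : 0 < t) {xi : Pair X Y}
    (h : A (planOf c t xi) = gradient (conjFn F) (-xi)) {g : Plan X Y} (hne : g ≠ planOf c t xi) :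
    regCost c F t (planOf c t xi) < regCost c F t g := by
  rw [regCost_planOf hF ht h]
  by_cases hg : ∀ p, 0 ≤ g p
  · have hc := le_cost (c := c) hF g xi
    have hlt : ∑ p, (g p * Real.log (planOf c t xi p) - planOf c t xi p) <
        ∑ p, (g p * Real.log (g p) - g p) := by
      obtain ⟨q, hq⟩ : ∃ q, g q ≠ planOf c t xi q := by
        by_contra! hall
        exact hne (PiLp.ext hall)
      exact Finset.sum_lt_sum (fun p _ => mul_log_sub_le (hg p) (planOf_pos c t xi p))
        ⟨q, Finset.mem_univ q, mul_log_sub_lt (hg q) (planOf_pos c t xi q) hq⟩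
    have hlt' := mul_lt_mul_of_pos_left hlt (one_div_pos.2 ht)
    have hs : 1 / t * ∑ p, (g p * Real.log (planOf c t xi p) - planOf c t xi p) =
        -∑ p, (c p - Astar xi p) * g p - 1 / t * ∑ p, planOf c t xi p := by
      rw [Finset.mul_sum, Finset.mul_sum, ← Finset.sum_neg_distrib, ← Finset.sum_sub_distrib]
      refine Finset.sum_congr rfl fun p _ => ?_
      rw [log_planOf]
      field_simp
      ring
    have he : entropyFn g = ∑ p, (g p * Real.log (g p) - g p) :=
      Finset.sum_congr rfl fun p _ => by ring
    rw [hs, ← he] at hlt'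
    rw [regCost, entropy_of_nonneg hg, ← EReal.coe_mul]
    refine lt_of_lt_of_le ?_ (add_le_add_left hc _)
    rw [← EReal.coe_add, EReal.coe_lt_coe_iff]
    linarith
  · rw [regCost, entropy_of_not_nonneg hg, EReal.coe_mul_top_of_pos (one_div_pos.2 ht),
      EReal.add_top_of_ne_bot]
    · exact EReal.coe_lt_top _
    · intro hb
      have := le_cost (c := c) hF g xi
      rw [hb, le_bot_iff] at this
      exact EReal.coe_ne_bot _ this

end Primal

end

end UOT

namespace UOT

noncomputable section

variable {X Y : Type*} [Fintype X] [Fintype Y] {c : Plan X Y} {F : Pair X Y → EReal}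

/-! ### Saddle points of the unregularized problem -/

section Saddle

/-- Primal-dual optimality of a plan `g` and a pair of potentials `xi` for the unregularized
problem: primal and dual feasibility, the marginal condition and complementary slackness. -/
structure IsSaddle (c : Plan X Y) (F : Pair X Y → EReal) (xi : Pair X Y) (g : Plan X Y) : Prop where
  nonneg : ∀ p, 0 ≤ g p
  potential_le : ∀ p, Astar xi p ≤ c p
  marginal_eq : A g = gradient (conjFn F) (-xi)
  slack : ∑ p, (c p - Astar xi p) * g p = 0

/-- The saddle fixes the optimal value at `-F*(-ξ)`, so any optimal plan has equality both in weak
duality and in the nonnegativity of the slackness. Hence the same `ξ` certifies every optimal plan.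
-/
theorem IsSaddle.isOptPlan_iff (hF : Assumptions F) {xi : Pair X Y} {g₀ : Plan X Y}
    (h : IsSaddle c F xi g₀) (g : Plan X Y) : IsOptPlan c F g ↔ IsSaddle c F xi g := by
  have hval := (cost_eq_iff (c := c) hF g₀ xi).2 h.marginal_eq
  rw [h.slack] at hval
  have hnn : ∀ g : Plan X Y, (∀ p, 0 ≤ g p) → 0 ≤ ∑ p, (c p - Astar xi p) * g p := fun g hg =>
    Finset.sum_nonneg fun p _ => mul_nonneg (sub_nonneg.2 (h.potential_le p)) (hg p)
  constructor
  · rintro ⟨hg, hmin⟩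
    have h1 := hmin g₀ h.nonneg
    have h2 := le_cost (c := c) hF g xi
    rw [hval] at h1
    have h3 := h2.trans h1
    rw [EReal.coe_le_coe_iff] at h3
    have h4 : ∑ p, (c p - Astar xi p) * g p = 0 := le_antisymm (by linarith) (hnn g hg)
    refine ⟨hg, h.potential_le, (cost_eq_iff (c := c) hF g xi).1 (le_antisymm ?_ h2), h4⟩
    rwa [h4]
  · intro hs
    have hval' := (cost_eq_iff (c := c) hF g xi).2 hs.marginal_eq
    rw [hs.slack] at hval'
    refine ⟨hs.nonneg, fun g' hg' => ?_⟩
    rw [hval']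
    refine le_trans ?_ (le_cost (c := c) hF g' xi)
    rw [EReal.coe_le_coe_iff]
    linarith [hnn g' hg']

/-- Each term is `-γ log γ / t`, and `γ log γ ≥ γ - 1 ≥ -1`. -/
theorem sum_slack_planOf_le (c : Plan X Y) {t : ℝ} (ht : 0 < t) (xi : Pair X Y) :
    ∑ p, (c p - Astar xi p) * planOf c t xi p ≤ Fintype.card (X × Y) / t := by
  have : ∀ p ∈ Finset.univ, (c p - Astar xi p) * planOf c t xi p ≤ 1 / t := by
    intro p _
    have hpos := planOf_pos c t xi p
    have h1 := Real.one_sub_inv_le_log_of_pos hpos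
    have h2 := mul_le_mul_of_nonneg_left h1 hpos.le
    rw [mul_sub, mul_inv_cancel₀ hpos.ne', log_planOf] at h2
    rw [le_div_iff₀ ht]
    linarith
  refine (Finset.sum_le_card_nsmul _ _ _ this).trans (le_of_eq ?_)
  rw [nsmul_eq_mul, Finset.card_univ]
  ring

theorem apply_le_A_apply {g : Plan X Y} (hg : ∀ p, 0 ≤ g p) (p : X × Y) :
    g p ≤ A g (Sum.inl p.1) :=
  Finset.single_le_sum (f := fun y => g (p.1, y)) (fun _ _ => hg _) (Finset.mem_univ p.2)

theorem norm_le_of_norm_A_le {g : Plan X Y} (hg : ∀ p, 0 ≤ g p) {B : ℝ} (hB : ‖A g‖ ≤ B) :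
    ‖g‖ ≤ √(∑ _p : X × Y, B ^ 2) := by
  rw [EuclideanSpace.norm_eq]
  refine Real.sqrt_le_sqrt (Finset.sum_le_sum fun p _ => ?_)
  refine pow_le_pow_left₀ (norm_nonneg _) ?_ 2
  rw [Real.norm_of_nonneg (hg p)]
  exact (apply_le_A_apply hg p).trans
    ((le_abs_self _).trans ((PiLp.norm_apply_le (A g) (Sum.inl p.1)).trans hB))

/-- Cluster points of the regularized solutions are saddle points. -/
theorem exists_isSaddle [Nonempty X] [Nonempty Y] (hc : ∀ p, 0 ≤ c p) (hF : Assumptions F) :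
    ∃ xi g, IsSaddle c F xi g := by
  have htpos : ∀ n : ℕ, (0 : ℝ) < n + 1 := fun n => by positivity
  choose xi hxi using fun n : ℕ => exists_isRegDual (c := c) hF (htpos n)
  have hfo := fun n => A_planOf_eq hF (htpos n) (hxi n)
  -- This level bounds the dual value at `ξ = 0` for all `t ≥ 1`, because `c ≥ 0`.
  obtain ⟨R, hR⟩ := exists_norm_le_of_dualFn_le (c := c) hF (conjFn F 0 + Fintype.card (X × Y))
  have hxiR : ∀ n, ‖xi n‖ ≤ R := by
    intro n
    refine hR _ (htpos n) _ (((isRegDual_iff hF _ _).1 (hxi n) 0).trans ?_)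
    rw [dualFn, neg_zero]
    have : ∀ p ∈ Finset.univ, 1 / ((n : ℝ) + 1) *
        Real.exp ((n + 1) * (Astar (0 : Pair X Y) p - c p)) ≤ 1 := by
      intro p _
      have h1 : (1 : ℝ) / (n + 1) ≤ 1 := by
        rw [div_le_one (htpos n)]
        linarith [n.cast_nonneg (α := ℝ)]
      have h2 : Real.exp ((n + 1) * (Astar (0 : Pair X Y) p - c p)) ≤ 1 := by
        rw [Real.exp_le_one_iff]
        refine mul_nonpos_of_nonneg_of_nonpos (htpos n).le ?_
        simpa [Astar] using hc p
      exact mul_le_one₀ h1 (Real.exp_pos _).le h2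
    have := Finset.sum_le_card_nsmul _ _ _ this
    rw [nsmul_eq_mul, Finset.card_univ, mul_one] at this
    linarith
  have hgc : Continuous (gradient (conjFn F)) := (contDiff_gradient_conjFn hF).continuous
  obtain ⟨B, hB⟩ := (isCompact_closedBall (0 : Pair X Y) R).exists_bound_of_continuousOn
    (f := fun z => gradient (conjFn F) (-z)) (by fun_prop)
  have hAB : ∀ n : ℕ, ‖A (planOf c (n + 1) (xi n))‖ ≤ B := fun n => by
    rw [hfo n]
    exact hB _ (by simpa using hxiR n)
  have hgnn : ∀ (n : ℕ) p, 0 ≤ planOf c (n + 1) (xi n) p := fun n p => (planOf_pos _ _ _ p).le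
  obtain ⟨⟨xi₀, g₀⟩, -, φ, hφ, hlim⟩ :=
    ((isCompact_closedBall (0 : Pair X Y) R).prod
      (isCompact_closedBall (0 : Plan X Y) √(∑ _p : X × Y, B ^ 2))).tendsto_subseq
      (x := fun n : ℕ => (xi n, planOf c (n + 1) (xi n)))
      (fun n => ⟨by simpa using hxiR n, by simpa using norm_le_of_norm_A_le (hgnn n) (hAB n)⟩)
  have hx : Tendsto (fun n => xi (φ n)) atTop (𝓝 xi₀) := (continuous_fst.tendsto _).comp hlim
  have hg : Tendsto (fun n => planOf c ((φ n : ℕ) + 1) (xi (φ n))) atTop (𝓝 g₀) :=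
    (continuous_snd.tendsto _).comp hlim
  have hinv : ∀ a : ℝ, Tendsto (fun n => a / ((φ n : ℝ) + 1)) atTop (𝓝 0) := fun a =>
    ((tendsto_const_div_atTop_nhds_zero_nat a).comp (tendsto_add_atTop_nat 1)).comp
      hφ.tendsto_atTop |>.congr fun n => by simp
  have hAx : ∀ p, Tendsto (fun n => Astar (xi (φ n)) p) atTop (𝓝 (Astar xi₀ p)) := fun p =>
    ((by fun_prop : Continuous fun z : Pair X Y => Astar z p).tendsto _).comp hx
  have hgp : ∀ p, Tendsto (fun n => planOf c ((φ n : ℕ) + 1) (xi (φ n)) p) atTop (𝓝 (g₀ p)) :=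
    fun p => ((by fun_prop : Continuous fun z : Plan X Y => z p).tendsto _).comp hg
  have hnn : ∀ p, 0 ≤ g₀ p := fun p =>
    ge_of_tendsto (hgp p) (Eventually.of_forall fun n => hgnn _ p)
  -- The entries `exp (t s)` stay below `B`, so `s ≤ B / t`, which tends to `0`.
  have hle : ∀ p, Astar xi₀ p ≤ c p := by
    intro p
    have := le_of_tendsto_of_tendsto' ((hAx p).sub_const (c p)) (hinv B) fun n => by
      have h1 := (apply_le_A_apply (hgnn (φ n)) p).trans
        ((le_abs_self _).trans ((PiLp.norm_apply_le _ (Sum.inl p.1)).trans (hAB (φ n))))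
      rw [planOf_apply] at h1
      have h2 := Real.add_one_le_exp (((φ n : ℝ) + 1) * (Astar (xi (φ n)) p - c p))
      rw [le_div_iff₀ (htpos _)]
      linarith
    linarith
  refine ⟨xi₀, g₀, hnn, hle, ?_, le_antisymm ?_ (Finset.sum_nonneg fun p _ =>
    mul_nonneg (sub_nonneg.2 (hle p)) (hnn p))⟩
  · refine tendsto_nhds_unique ((continuous_A.tendsto _).comp hg) ?_
    have h1 : Tendsto (fun n => gradient (conjFn F) (-xi (φ n))) atTop
        (𝓝 (gradient (conjFn F) (-xi₀))) := (hgc.tendsto _).comp hx.neg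
    exact h1.congr fun n => (hfo (φ n)).symm
  · exact le_of_tendsto_of_tendsto'
      (tendsto_finsetSum _ fun p _ => (tendsto_const_nhds.sub (hAx p)).mul (hgp p))
      (hinv (Fintype.card (X × Y))) fun n => sum_slack_planOf_le c (htpos _) _

end Saddle

/-! ### The optimal plan of minimal entropy -/

section MinEntropy

theorem continuous_entropyFn : Continuous (entropyFn : Plan X Y → ℝ) := by
  have : (entropyFn : Plan X Y → ℝ) = fun g => ∑ p, (g p * Real.log (g p) - g p) := by
    funext g
    exact Finset.sum_congr rfl fun p _ => by ring
  rw [this]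
  refine continuous_finsetSum _ fun p _ => ?_
  exact (Real.continuous_mul_log.comp (by fun_prop : Continuous fun g : Plan X Y => g p)).sub
    (by fun_prop)

theorem IsSaddle.isMinEntropyOptPlan_iff (hF : Assumptions F) {xi : Pair X Y} {g₀ : Plan X Y}
    (h : IsSaddle c F xi g₀) (g : Plan X Y) : IsMinEntropyOptPlan c F g ↔
      IsSaddle c F xi g ∧ ∀ g', IsSaddle c F xi g' → entropyFn g ≤ entropyFn g' := by
  simp only [IsMinEntropyOptPlan, h.isOptPlan_iff hF]
  refine and_congr_right fun hg => forall₂_congr fun g' hg' => ?_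
  rw [entropy_of_nonneg hg.nonneg, entropy_of_nonneg hg'.nonneg, EReal.coe_le_coe_iff]

/-- The optimal plans form a compact set: they share their marginals, and a nonnegative plan is
bounded by its marginals. -/
theorem IsSaddle.exists_isMinEntropyOptPlan (hF : Assumptions F) {xi : Pair X Y} {g₀ : Plan X Y}
    (h : IsSaddle c F xi g₀) : ∃ g, IsMinEntropyOptPlan c F g := by
  simp only [h.isMinEntropyOptPlan_iff hF]
  have hset : {g | IsSaddle c F xi g} = (⋂ p, {g : Plan X Y | 0 ≤ g p}) ∩
      ({g | A g = gradient (conjFn F) (-xi)} ∩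
        {g | ∑ p, (c p - Astar xi p) * g p = 0}) := by
    ext g
    simp only [mem_inter_iff, mem_iInter, mem_ofPred_eq]
    exact ⟨fun hg => ⟨hg.nonneg, hg.marginal_eq, hg.slack⟩,
      fun hg => ⟨hg.1, h.potential_le, hg.2.1, hg.2.2⟩⟩
  have hcomp : IsCompact {g | IsSaddle c F xi g} := by
    refine Metric.isCompact_of_isClosed_isBounded ?_ ?_
    · rw [hset]
      refine (isClosed_iInter fun p => isClosed_le (by fun_prop) (by fun_prop)).inter
        (IsClosed.inter ?_ ?_)
      · exact isClosed_eq (by fun_prop) (by fun_prop)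
      · exact isClosed_eq (by fun_prop) (by fun_prop)
    · refine (Metric.isBounded_closedBall (x := (0 : Plan X Y))
        (r := √(∑ _p : X × Y, ‖gradient (conjFn F) (-xi)‖ ^ 2))).subset fun g hg => ?_
      rw [mem_closedBall_zero_iff]
      exact norm_le_of_norm_A_le hg.nonneg (by rw [hg.marginal_eq])
  obtain ⟨g, hg, hmin⟩ := hcomp.exists_isMinOn ⟨g₀, h⟩ continuous_entropyFn.continuousOn
  exact ⟨g, hg, fun g' hg' => hmin hg'⟩

theorem IsMinEntropyOptPlan.eq (hF : Assumptions F) {xi : Pair X Y} {g₀ : Plan X Y}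
    (h : IsSaddle c F xi g₀) {g g' : Plan X Y} (hg : IsMinEntropyOptPlan c F g)
    (hg' : IsMinEntropyOptPlan c F g') : g' = g := by
  rw [h.isMinEntropyOptPlan_iff hF] at hg hg'
  by_contra hne
  obtain ⟨q, hq⟩ : ∃ q, g' q ≠ g q := by
    by_contra! hall
    exact hne (PiLp.ext hall)
  -- The midpoint is again a saddle plan, and strict convexity of `x log x` gives it smaller
  -- entropy.
  set m : Plan X Y := (1 / 2 : ℝ) • g' + (1 / 2 : ℝ) • g with hm
  have hmp : ∀ p, m p = 1 / 2 * g' p + 1 / 2 * g p := fun p => by simp [hm]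
  have hms : IsSaddle c F xi m := by
    refine ⟨fun p => ?_, h.potential_le, ?_, ?_⟩
    · rw [hmp]
      have := hg.1.nonneg p
      have := hg'.1.nonneg p
      positivity
    · rw [hm, A_add, A_smul, A_smul, hg.1.marginal_eq, hg'.1.marginal_eq, ← add_smul]
      norm_num
    · have h1 : ∑ p, (c p - Astar xi p) * m p = 1 / 2 * ∑ p, (c p - Astar xi p) * g' p +
          1 / 2 * ∑ p, (c p - Astar xi p) * g p := by
        rw [Finset.mul_sum, Finset.mul_sum, ← Finset.sum_add_distrib]
        exact Finset.sum_congr rfl fun p _ => by rw [hmp]; ring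
      rw [h1, hg.1.slack, hg'.1.slack]
      norm_num
  have hle : ∀ p, m p * (Real.log (m p) - 1) ≤
      1 / 2 * (g' p * (Real.log (g' p) - 1)) + 1 / 2 * (g p * (Real.log (g p) - 1)) := by
    intro p
    have := Real.convexOn_mul_log.2 (hg'.1.nonneg p) (hg.1.nonneg p)
      (by norm_num : (0 : ℝ) ≤ 1 / 2) (by norm_num : (0 : ℝ) ≤ 1 / 2) (by norm_num)
    simp only [smul_eq_mul, ← hmp] at this
    linarith [hmp p]
  have hlt : m q * (Real.log (m q) - 1) <
      1 / 2 * (g' q * (Real.log (g' q) - 1)) + 1 / 2 * (g q * (Real.log (g q) - 1)) := by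
    have := Real.strictConvexOn_mul_log.2 (hg'.1.nonneg q) (hg.1.nonneg q) hq
      (by norm_num : (0 : ℝ) < 1 / 2) (by norm_num : (0 : ℝ) < 1 / 2) (by norm_num)
    simp only [smul_eq_mul, ← hmp] at this
    linarith [hmp q]
  have hsum := Finset.sum_lt_sum (fun p _ => hle p) ⟨q, Finset.mem_univ q, hlt⟩
  rw [Finset.sum_add_distrib, ← Finset.mul_sum, ← Finset.mul_sum] at hsum
  have h1 := hg.2 m hms
  have h2 := hg'.2 m hms
  simp only [entropyFn] at h1 h2
  linarith

/-- First-order optimality of the plan of minimal entropy: a feasible direction does not leave the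
support, and the entropy does not decrease along it. -/
theorem IsSaddle.entropy_first_order {xi : Pair X Y} {g : Plan X Y}
    (hg : IsSaddle c F xi g) (hmin : ∀ g', IsSaddle c F xi g' → entropyFn g ≤ entropyFn g')
    {k : Plan X Y} (hA : A k = 0) (hslack : ∑ p, (c p - Astar xi p) * k p = 0)
    (hk : ∀ p, g p = 0 → 0 ≤ k p) :
    (∀ p, g p = 0 → k p = 0) ∧ 0 ≤ ∑ p, k p * Real.log (g p) := by
  have hcont : ∀ p, Tendsto (fun ε : ℝ => g p + ε * k p) (𝓝[>] 0) (𝓝 (g p)) := fun p => by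
    have : Tendsto (fun ε : ℝ => g p + ε * k p) (𝓝 0) (𝓝 (g p + 0 * k p)) :=
      (by fun_prop : Continuous fun ε : ℝ => g p + ε * k p).tendsto 0
    rw [zero_mul, add_zero] at this
    exact this.mono_left nhdsWithin_le_nhds
  have hpos : ∀ᶠ ε : ℝ in 𝓝[>] 0, ∀ p, 0 ≤ g p + ε * k p ∧ (k p ≠ 0 → 0 < g p + ε * k p) := by
    rw [eventually_all]
    intro p
    rcases (hg.nonneg p).eq_or_lt with h0 | h0
    · filter_upwards [self_mem_nhdsWithin] with ε hε
      have hε : 0 < ε := hε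
      have hk0 := hk p h0.symm
      rw [← h0, zero_add]
      exact ⟨by positivity, fun hne => mul_pos hε (hk0.lt_of_ne' hne)⟩
    · filter_upwards [(hcont p).eventually (lt_mem_nhds h0)] with ε hε
      exact ⟨hε.le, fun _ => hε⟩
  have hsum : ∀ᶠ ε : ℝ in 𝓝[>] 0, 0 ≤ ∑ p, k p * Real.log (g p + ε * k p) := by
    filter_upwards [hpos, self_mem_nhdsWithin] with ε hε hε0
    have hε0 : 0 < ε := hε0
    have hp : ∀ p, (g + ε • k) p = g p + ε * k p := fun p => by simp
    have hs : IsSaddle c F xi (g + ε • k) := by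
      refine ⟨fun p => by rw [hp]; exact (hε p).1, hg.potential_le, ?_, ?_⟩
      · rw [A_add, A_smul, hA, smul_zero, add_zero, hg.marginal_eq]
      · have h1 : ∑ p, (c p - Astar xi p) * (g + ε • k) p =
            ∑ p, (c p - Astar xi p) * g p + ε * ∑ p, (c p - Astar xi p) * k p := by
          rw [Finset.mul_sum, ← Finset.sum_add_distrib]
          exact Finset.sum_congr rfl fun p _ => by rw [hp]; ring
        rw [h1, hg.slack, hslack, mul_zero, add_zero]
    -- Kullback–Leibler gives `Ent(g + εk) - Ent(g) ≤ ε ∑ k log (g + εk)`, with no derivative of the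
    -- entropy at the boundary.
    have hterm : entropyFn (g + ε • k) ≤
        ∑ p, (g p * (Real.log (g p) - 1) + ε * (k p * Real.log (g p + ε * k p))) := by
      refine Finset.sum_le_sum fun p _ => ?_
      rw [hp]
      rcases eq_or_ne (k p) 0 with h0 | h0
      · simp [h0]
      · have := mul_log_sub_le (hg.nonneg p) ((hε p).2 h0)
        linarith
    rw [Finset.sum_add_distrib, ← Finset.mul_sum] at hterm
    have h1 := hmin _ hs
    have h2 : entropyFn g = ∑ p, g p * (Real.log (g p) - 1) := rfl
    have h3 : 0 ≤ ε * ∑ p, k p * Real.log (g p + ε * k p) := by linarith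
    exact nonneg_of_mul_nonneg_right h3 hε0
  have hlim : ∀ p, g p ≠ 0 ∨ k p = 0 →
      Tendsto (fun ε : ℝ => k p * Real.log (g p + ε * k p)) (𝓝[>] 0)
        (𝓝 (k p * Real.log (g p))) := by
    rintro p (h | h)
    · exact ((hcont p).log h).const_mul _
    · simp [h]
  have hbot : ∀ p, g p = 0 → k p ≠ 0 →
      Tendsto (fun ε : ℝ => k p * Real.log (g p + ε * k p)) (𝓝[>] 0) atBot := by
    intro p h0 hne
    have hkp : 0 < k p := (hk p h0).lt_of_ne' hne
    refine Tendsto.const_mul_atBot hkp (Real.tendsto_log_nhdsGT_zero.comp ?_)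
    refine tendsto_nhdsWithin_iff.2 ⟨by simpa [h0] using hcont p, ?_⟩
    filter_upwards [self_mem_nhdsWithin] with ε hε
    rw [h0, zero_add]
    exact mul_pos hε hkp
  -- If `k` were positive off the support, that term would tend to `-∞` while the others stay
  -- bounded above, against `hsum`.
  have hsupp : ∀ p, g p = 0 → k p = 0 := by
    classical
    intro q hq0
    by_contra hqk
    have hub : ∀ᶠ ε : ℝ in 𝓝[>] 0, ∀ p,
        k p * Real.log (g p + ε * k p) ≤ k p * Real.log (g p) + 1 := by
      rw [eventually_all]
      intro p
      by_cases h : g p ≠ 0 ∨ k p = 0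
      · exact ((hlim p h).eventually (gt_mem_nhds (lt_add_one _))).mono fun _ h => h.le
      · push Not at h
        exact (hbot p h.1 h.2).eventually_le_atBot _
    have hq := (hbot q hq0 hqk).eventually_lt_atBot
      (-∑ p ∈ Finset.univ.erase q, (k p * Real.log (g p) + 1))
    obtain ⟨ε, h1, h2, h3⟩ := (hsum.and (hub.and hq)).exists
    rw [← Finset.add_sum_erase _ _ (Finset.mem_univ q)] at h1
    have h4 := Finset.sum_le_sum fun p (_ : p ∈ Finset.univ.erase q) => h2 p
    linarith
  refine ⟨hsupp, ge_of_tendsto (tendsto_finsetSum _ fun p _ => hlim p ?_) hsum⟩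
  by_cases h : g p = 0
  · exact Or.inr (hsupp p h)
  · exact Or.inl h

end MinEntropy

end

end UOT

/-! ### Rates of convergence -/

namespace UOT

noncomputable section

variable {X Y : Type*} [Fintype X] [Fintype Y] {c : Plan X Y} {F : Pair X Y → EReal}

/-- The regularized potentials minimize the dual functional up to an error of order `1 / t`. -/
theorem IsSaddle.conjFn_gap_le (hF : Assumptions F) {xi₀ : Pair X Y} {g : Plan X Y}
    (hg : IsSaddle c F xi₀ g) {t : ℝ} (ht : 0 < t) {xi : Pair X Y} (hxi : IsRegDual c F t xi) :
    conjFn F (-xi) - conjFn F (-xi₀) - inner ℝ (gradient (conjFn F) (-xi₀)) (-xi - -xi₀) ≤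
      (Fintype.card (X × Y) + |entropyFn g|) / t := by
  have h1 := (isRegDual_iff hF t xi).1 hxi xi₀
  rw [dualFn, dualFn, ← Finset.mul_sum, ← Finset.mul_sum] at h1
  have h2 : ∑ p, Real.exp (t * (Astar xi₀ p - c p)) ≤ Fintype.card (X × Y) := by
    have : ∀ p ∈ Finset.univ, Real.exp (t * (Astar xi₀ p - c p)) ≤ 1 := fun p _ => by
      rw [Real.exp_le_one_iff]
      exact mul_nonpos_of_nonneg_of_nonpos ht.le (sub_nonpos.2 (hg.potential_le p))
    simpa [Finset.card_univ] using Finset.sum_le_card_nsmul _ _ _ this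
  -- Slackness of `g` replaces `A* ξ₀` by `c` on its support, turning the linear term into `log
  -- γ(t)` paired with `g`.
  have h3 : inner ℝ (gradient (conjFn F) (-xi₀)) (-xi - -xi₀) =
      -(1 / t * ∑ p, g p * Real.log (planOf c t xi p)) := by
    have h : -xi - -xi₀ = -(xi - xi₀) := by abel
    rw [h, inner_neg_right, ← hg.marginal_eq, ← sum_mul_Astar, neg_inj, Finset.mul_sum,
      ← sub_eq_zero, ← Finset.sum_sub_distrib, ← hg.slack]
    refine Finset.sum_congr rfl fun p _ => ?_
    rw [log_planOf, Astar_sub, PiLp.sub_apply]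
    field_simp
    ring
  have h4 : ∑ p, g p * Real.log (planOf c t xi p) -
      ∑ p, Real.exp (t * (Astar xi p - c p)) ≤ |entropyFn g| := by
    rw [← Finset.sum_sub_distrib]
    refine le_trans (Finset.sum_le_sum fun p _ => ?_) (le_abs_self _)
    have := mul_log_sub_le (hg.nonneg p) (planOf_pos c t xi p)
    rw [planOf_apply] at this ⊢
    linarith
  have h5 := mul_le_mul_of_nonneg_left (add_le_add h2 h4) (one_div_pos.2 ht).le
  rw [h3, div_eq_mul_one_div (_ + _) t, mul_comm (_ + _) (1 / t)]
  linarith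

/-- The regularized potentials converge at rate `1 / √t`. -/
theorem IsSaddle.exists_norm_potential_sub_le (hF : Assumptions F) {xi₀ : Pair X Y} {g : Plan X Y}
    (hg : IsSaddle c F xi₀ g) {ρ : ℝ} (hρ : 0 < ρ) :
    ∃ C > 0, ∃ T > 0, ∀ t, T ≤ t → ∀ xi, IsRegDual c F t xi →
      ‖xi - xi₀‖ < ρ ∧ ‖xi - xi₀‖ ≤ C / √t := by
  obtain ⟨r, hr, l, hl, hnear, hfar⟩ := exists_quadratic_growth hF.proper hF.lsc hF.superLinear
    (hasGradientAt_conjFn hF (-xi₀)) (stronglyConvexAt_conj hF (-xi₀))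
  set D : ℝ := Fintype.card (X × Y) + |entropyFn g|
  have hD0 : 0 ≤ D := by positivity
  -- The summands of the threshold make `t` positive and push `D / t` below `l r²`, which excludes
  -- the far regime of the growth bound, and below `l ρ²`, which gives distance less than `ρ`.
  refine ⟨√(D / l) + 1, by positivity, 1 + D / (l * r ^ 2) + D / (l * ρ ^ 2), by positivity,
    fun t ht xi hxi => ?_⟩
  have e1 : 0 ≤ D / (l * r ^ 2) := by positivity
  have e2 : 0 ≤ D / (l * ρ ^ 2) := by positivity
  have ht0 : 0 < t := by linarith
  have hgap := hg.conjFn_gap_le hF ht0 hxi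
  have hn : ‖-xi - -xi₀‖ = ‖xi - xi₀‖ := by rw [← norm_neg]; congr 1; abel
  have hDt : ∀ s > 0, D / (l * s ^ 2) < t → D / t < l * s ^ 2 := fun s hs h => by
    rw [div_lt_iff₀ (by positivity)] at h
    rw [div_lt_iff₀ ht0]
    linarith
  have hlt : ‖xi - xi₀‖ < r := by
    by_contra! hle
    have h1 := hfar (-xi) (by rwa [hn])
    have h2 := hDt r hr (by linarith)
    simp only [conjFn] at *
    linarith
  have hquad : l * ‖xi - xi₀‖ ^ 2 ≤ D / t := by
    have h1 := hnear (-xi) (by rw [hn]; exact hlt.le)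
    rw [hn] at h1
    simp only [conjFn] at *
    linarith
  constructor
  · refine lt_of_pow_lt_pow_left₀ 2 hρ.le ?_
    exact lt_of_mul_lt_mul_left (hquad.trans_lt (hDt ρ hρ (by linarith))) hl.le
  · have h1 : ‖xi - xi₀‖ ≤ √(D / l) / √t := by
      rw [← Real.sqrt_div (by positivity)]
      refine Real.le_sqrt_of_sq_le ?_
      rw [div_right_comm, le_div_iff₀ hl]
      linarith
    exact h1.trans (by gcongr; linarith)

/-- The marginal map augmented by the total violation of complementary slackness. -/
def slackMarginal (c : Plan X Y) (xi : Pair X Y) : Plan X Y →ₗ[ℝ] Pair X Y × ℝ :=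
  (marginal X Y).prod
    { toFun := fun g => ∑ p, (c p - Astar xi p) * g p
      map_add' := fun g h => by simp [mul_add, Finset.sum_add_distrib]
      map_smul' := fun a g => by
        simp only [PiLp.smul_apply, smul_eq_mul, RingHom.id_apply, Finset.mul_sum]
        exact Finset.sum_congr rfl fun p _ => by ring }

theorem slackMarginal_apply (c : Plan X Y) (xi : Pair X Y) (g : Plan X Y) :
    slackMarginal c xi g = (A g, ∑ p, (c p - Astar xi p) * g p) := rfl

/-- The error of the regularized plan is conformal to no nonzero vector of the kernel of
`slackMarginal`. -/
theorem IsSaddle.eq_zero_of_signCompatible {xi₀ : Pair X Y} {g : Plan X Y}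
    (hg : IsSaddle c F xi₀ g) (hmin : ∀ g', IsSaddle c F xi₀ g' → entropyFn g ≤ entropyFn g')
    (t : ℝ) (xi : Pair X Y) {k : Plan X Y} (hk : slackMarginal c xi₀ k = 0)
    (hsign : SignCompatible k (planOf c t xi - g).ofLp) : k = 0 := by
  rw [slackMarginal_apply, Prod.mk_eq_zero] at hk
  obtain ⟨hA, hs⟩ := hk
  have hsub : ∀ p, (planOf c t xi - g) p = planOf c t xi p - g p := fun p => rfl
  obtain ⟨hsupp, hfo⟩ := hg.entropy_first_order hmin hA hs fun p hp => (hsign p).1 (by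
    rw [hsub, hp, sub_zero]; exact (planOf_pos c t xi p).le)
  -- Here `log γ(t) = t (A* (ξ - ξ₀) - (c - A* ξ₀))`, and `k` is orthogonal to both parts.
  have hplan : ∑ p, k p * Real.log (planOf c t xi p) = 0 := by
    have h1 : ∑ p, k p * Real.log (planOf c t xi p) =
        t * (∑ p, k p * Astar (xi - xi₀) p - ∑ p, (c p - Astar xi₀ p) * k p) := by
      rw [← Finset.sum_sub_distrib, Finset.mul_sum]
      refine Finset.sum_congr rfl fun p _ => ?_
      rw [log_planOf, Astar_sub, PiLp.sub_apply]
      ring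
    rw [h1, hs, sum_mul_Astar, hA, inner_zero_left, sub_zero, mul_zero]
  -- On the support of `g`, monotonicity of `log` gives both factors the same sign; off it `k`
  -- vanishes, so the value of `Real.log 0` is irrelevant.
  have hterm : ∀ p ∈ Finset.univ,
      0 ≤ k p * (Real.log (planOf c t xi p) - Real.log (g p)) := by
    intro p _
    by_cases hp : g p = 0
    · rw [hsupp p hp, zero_mul]
    have hp' : 0 < g p := (hg.nonneg p).lt_of_ne' hp
    rcases le_total (g p) (planOf c t xi p) with h | h
    · exact mul_nonneg ((hsign p).1 (by rw [hsub]; linarith))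
        (sub_nonneg.2 (Real.log_le_log hp' h))
    · exact mul_nonneg_of_nonpos_of_nonpos ((hsign p).2 (by rw [hsub]; linarith))
        (sub_nonpos.2 (Real.log_le_log (planOf_pos c t xi p) h))
  -- The sum of these nonnegative terms equals `-∑ k log g`, which is at most `0` by first-order
  -- optimality of the entropy.
  have hsum : ∑ p, k p * (Real.log (planOf c t xi p) - Real.log (g p)) = 0 := by
    refine le_antisymm ?_ (Finset.sum_nonneg hterm)
    simp only [mul_sub, Finset.sum_sub_distrib, hplan]
    linarith
  refine PiLp.ext fun p => ?_
  change k p = 0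
  by_cases hp : g p = 0
  · exact hsupp p hp
  have hp' : 0 < g p := (hg.nonneg p).lt_of_ne' hp
  rcases mul_eq_zero.1 ((Finset.sum_eq_zero_iff_of_nonneg hterm).1 hsum p (Finset.mem_univ p))
    with h | h
  · exact h
  · have h0 : planOf c t xi p = g p :=
      Real.log_injOn_pos (planOf_pos c t xi p) hp' (sub_eq_zero.1 h)
    have h1 := (hsign p).1 (by rw [hsub, h0, sub_self])
    have h2 := (hsign p).2 (by rw [hsub, h0, sub_self])
    exact le_antisymm h2 h1

/-- The regularized plans converge to the plan of minimal entropy at rate `1 / √t`. -/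
theorem IsSaddle.exists_norm_planOf_sub_le (hF : Assumptions F) {xi₀ : Pair X Y} {g : Plan X Y}
    (hg : IsSaddle c F xi₀ g) (hmin : ∀ g', IsSaddle c F xi₀ g' → entropyFn g ≤ entropyFn g') :
    ∃ C > 0, ∃ T > 0, ∀ t, T ≤ t → ∀ xi, IsRegDual c F t xi →
      ‖planOf c t xi - g‖ ≤ C / √t := by
  obtain ⟨K, hK, hKv⟩ := exists_norm_le_of_signCompatible (slackMarginal c xi₀)
  obtain ⟨L, hL, ρ, hρ, hLip⟩ := exists_lipschitz_gradient_conjFn hF (-xi₀)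
  obtain ⟨C, hC, T, hT, hCT⟩ := hg.exists_norm_potential_sub_le hF hρ
  set N : ℝ := (Fintype.card (X × Y) : ℝ)
  have hN0 : 0 ≤ N := by positivity
  -- The term `L * C` is the marginal error and the rest is the slackness error. Adding `1` to `T`
  -- ensures `t ≥ 1`, so that `N / t ≤ N / √t`.
  refine ⟨K * (L * C + (N + (L * ρ + ‖A g‖) * C)), by positivity, T + 1, by positivity,
    fun t ht xi hxi => ?_⟩
  have ht0 : 0 < t := by linarith
  have hst : 0 < √t := Real.sqrt_pos.2 ht0
  obtain ⟨hxρ, hxC⟩ := hCT t (by linarith) xi hxi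
  have hn : ‖-xi - -xi₀‖ = ‖xi - xi₀‖ := by rw [← norm_neg]; congr 1; abel
  have hmarg : ‖A (planOf c t xi) - A g‖ ≤ L * ‖xi - xi₀‖ := by
    have := hLip (-xi) (by rwa [hn])
    rwa [hn, ← A_planOf_eq hF ht0 hxi, ← hg.marginal_eq] at this
  have hmarg' : ‖A (planOf c t xi)‖ ≤ L * ρ + ‖A g‖ := by
    have h1 := norm_sub_norm_le (A (planOf c t xi)) (A g)
    have h2 := mul_le_mul_of_nonneg_left hxρ.le hL.le
    linarith
  have hslack0 : 0 ≤ ∑ p, (c p - Astar xi₀ p) * planOf c t xi p :=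
    Finset.sum_nonneg fun p _ =>
      mul_nonneg (sub_nonneg.2 (hg.potential_le p)) (planOf_pos c t xi p).le
  have hslack : ∑ p, (c p - Astar xi₀ p) * planOf c t xi p ≤
      N / √t + (L * ρ + ‖A g‖) * (C / √t) := by
    -- Replacing `ξ₀` by `ξ(t)` leaves a slackness of order `1 / t` and an inner product controlled
    -- by the potential error.
    have h1 : ∑ p, (c p - Astar xi₀ p) * planOf c t xi p =
        ∑ p, (c p - Astar xi p) * planOf c t xi p + inner ℝ (A (planOf c t xi)) (xi - xi₀) := by
      rw [← sum_mul_Astar, ← Finset.sum_add_distrib]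
      refine Finset.sum_congr rfl fun p _ => ?_
      rw [Astar_sub, PiLp.sub_apply]
      ring
    have h2 := sum_slack_planOf_le c ht0 xi
    have h3 := real_inner_le_norm (A (planOf c t xi)) (xi - xi₀)
    have h4 : N / t ≤ N / √t := by
      refine div_le_div_of_nonneg_left hN0 hst ?_
      rw [Real.sqrt_le_left ht0.le]
      nlinarith
    have h5 : ‖A (planOf c t xi)‖ * ‖xi - xi₀‖ ≤ (L * ρ + ‖A g‖) * (C / √t) :=
      mul_le_mul hmarg' hxC (norm_nonneg _) (by positivity)
    linarith
  refine (hKv _ fun k hk hs => hg.eq_zero_of_signCompatible hmin t xi hk hs).trans ?_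
  rw [mul_div_assoc]
  refine mul_le_mul_of_nonneg_left ?_ hK.le
  rw [map_sub, slackMarginal_apply, slackMarginal_apply, hg.slack, Prod.mk_sub_mk, sub_zero,
    Prod.norm_mk, Real.norm_of_nonneg hslack0]
  have h6 := hmarg.trans (mul_le_mul_of_nonneg_left hxC hL.le)
  refine (max_le_add_of_nonneg (norm_nonneg _) hslack0).trans
    ((add_le_add h6 hslack).trans (le_of_eq ?_))
  ring

end

end UOT

/-- Convergence rate of the entropically regularized unbalanced optimal transport plan. -/
theorem theorem4p7 {X Y : Type*} [Fintype X] [Fintype Y] [Nonempty X] [Nonempty Y]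
    (c : UOT.Plan X Y) (hc : ∀ p, 0 ≤ c p)
    (F : UOT.Pair X Y → EReal) (hF : UOT.Assumptions F) :
    ∃ (γ : ℝ → UOT.Plan X Y) (ξ : ℝ → UOT.Pair X Y) (γstar : UOT.Plan X Y),
      -- `γ t` is the unique solution of the regularized problem
      (∀ t : ℝ, 0 < t → UOT.IsRegPlan c F t (γ t) ∧ ∀ g, UOT.IsRegPlan c F t g → g = γ t) ∧
      -- `ξ t` is the unique solution of the regularized dual problem
      (∀ t : ℝ, 0 < t → UOT.IsRegDual c F t (ξ t) ∧ ∀ z, UOT.IsRegDual c F t z → z = ξ t) ∧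
      -- the two are linked by `γ(t) = exp (t (A* ξ(t) - c))`
      (∀ t : ℝ, 0 < t → ∀ p, γ t p = Real.exp (t * (UOT.Astar (ξ t) p - c p))) ∧
      -- `γstar` is the unique solution of minimal entropy of the unregularized problem
      (UOT.IsMinEntropyOptPlan c F γstar ∧
        ∀ g, UOT.IsMinEntropyOptPlan c F g → g = γstar) ∧
      -- the rate of convergence
      ∃ C : ℝ, 0 < C ∧ ∃ T : ℝ, 0 < T ∧ ∀ t : ℝ, T ≤ t →
        ‖γ t - γstar‖ ≤ C / Real.sqrt t := by
  choose! ξ hξ using fun (t : ℝ) (ht : 0 < t) => UOT.exists_isRegDual (c := c) hF ht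
  obtain ⟨xi₀, g₀, hsad⟩ := UOT.exists_isSaddle hc hF
  obtain ⟨γstar, hstar⟩ := hsad.exists_isMinEntropyOptPlan hF
  obtain ⟨hs, hmin⟩ := (hsad.isMinEntropyOptPlan_iff hF γstar).1 hstar
  obtain ⟨C, hC, T, hT, hrate⟩ := hs.exists_norm_planOf_sub_le hF hmin
  refine ⟨fun t => UOT.planOf c t (ξ t), ξ, γstar, fun t ht => ?_, fun t ht => ?_,
    fun t _ p => rfl, ⟨hstar, fun g hg => hstar.eq hF hsad hg⟩,
    C, hC, T, hT, fun t ht => hrate t ht _ (hξ t (hT.trans_le ht))⟩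
  · have hfo := UOT.A_planOf_eq hF ht (hξ t ht)
    refine ⟨fun g => ?_, fun g hg => ?_⟩
    · rcases eq_or_ne g (UOT.planOf c t (ξ t)) with rfl | hne
      · exact le_rfl
      · exact (UOT.regCost_planOf_lt hF ht hfo hne).le
    · by_contra hne
      exact absurd (hg _) (not_le.2 (UOT.regCost_planOf_lt hF ht hfo hne))
  · exact ⟨hξ t ht, fun z hz => (hξ t ht).eq hF ht hz⟩
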